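/- **Theorem S5.** For $N\ge 0$ let $\mathcal U_N$ be the unitary group on $N$ qubits, $\mathcal P_N=\{\pm1,\pm i\}\cdot\{I,X,Y,Z\}^{\otimes N}$ the Pauli group, and $\mathcal C_N=\{U\in\mathcal U_N : U\mathcal P_NU^\dagger=\mathcal P_N\}$ the Clifford group. For a subgroup $\mathcal G\subseteq\mathcal U_N$ put $$\mathcal U_{N,\mathcal G}=\{U\in\mathcal U_N : [U,G]=0\ \text{for all } G\in\mathcal G\},\qquad \mathcal C_{N,\mathcal G}=\mathcal C_N\cap\mathcal U_{N,\mathcal G}.$$ A compact subgroup $\mathcal X\subseteq\mathcal U_N$ is called a $\mathcal G$-symmetric unitary $t$-design if $\Phi_{t,\mathcal X}=\Phi_{t,\mathcal U_{N,\mathcal G}}$, where $\Phi_{t,\mathcal X}(L)=\int_{\mathcal X}U^{\otimes t}LU^{\dagger\otimes t}\,d\mu_{\mathcal X}(U)$ for every linear operator $L$ on $tN$ qubits, and $\mu_{\mathcal X}$ is the normalized Haar measure on $\mathcal X$. Let $M\ge 2$ and $n\ge 0$ be integers, $N=Mn$, let $\mathcal F$ be a connected Lie subgroup of $\mathcal U_n$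 (the image of a connected Lie group under an injective immersive smooth homomorphism; it need not be closed), and let $$\mathcal G=\{F^{\otimes M} : F\in\mathcal F\}\subseteq\mathcal U_N .$$ Then $\mathcal C_{N,\mathcal G}$ is a $\mathcal G$-symmetric unitary $2$-design if and only if $\mathcal U_{N,\mathcal G}=\mathcal U_N$. Moreover, $\mathcal U_{N,\mathcal G}=\mathcal U_N$ if and only if the symmetry is trivial up to phase, i.e. every $G\in\mathcal G$ has the form $G=e^{i\theta}I$ with $\theta\in\mathbb R$. -/

import Mathlib

open scoped Matrix Manifold ContDiff

noncomputable section

/-! ### Tensor products of matrices -/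

/-- The tensor product `A 0 ⊗ ⋯ ⊗ A (t - 1)` of square matrices on `ℂ^ι`, as a matrix on
`(ℂ^ι)^{⊗ t}`, whose standard basis is indexed by `Fin t → ι`. -/
def tensorMat {ι : Type} {t : ℕ} (A : Fin t → Matrix ι ι ℂ) :
    Matrix (Fin t → ι) (Fin t → ι) ℂ :=
  Matrix.of fun a b => ∏ k, A k (a k) (b k)

theorem tensorMat_mul {ι : Type} [Fintype ι] {t : ℕ} (A B : Fin t → Matrix ι ι ℂ) :
    tensorMat A * tensorMat B = tensorMat fun k => A k * B k := by
  classical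
  ext a b
  simp only [tensorMat, Matrix.mul_apply, Matrix.of_apply, ← Finset.prod_mul_distrib]
  rw [Finset.prod_univ_sum, Fintype.piFinset_univ]

theorem tensorMat_one {ι : Type} [DecidableEq ι] {t : ℕ} :
    tensorMat (fun _ : Fin t => (1 : Matrix ι ι ℂ)) = 1 := by
  ext a b
  simp only [tensorMat, Matrix.of_apply, Matrix.one_apply]
  by_cases h : a = b
  · simp [h]
  · obtain ⟨k, hk⟩ := Function.ne_iff.mp h
    rw [if_neg h]
    exact Finset.prod_eq_zero (Finset.mem_univ k) (by simp [hk])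

theorem tensorMat_conjTranspose {ι : Type} {t : ℕ} (A : Fin t → Matrix ι ι ℂ) :
    (tensorMat A)ᴴ = tensorMat fun k => (A k)ᴴ := by
  ext a b
  simp [tensorMat, Matrix.conjTranspose_apply]

/-- The homomorphism `U ↦ U^{⊗ t}` between unitary groups. -/
def tensorPow {ι : Type} [Fintype ι] [DecidableEq ι] (t : ℕ) :
    Matrix.unitaryGroup ι ℂ →* Matrix.unitaryGroup (Fin t → ι) ℂ where
  toFun U := ⟨tensorMat fun _ => (U : Matrix ι ι ℂ), by
    have hU : (U : Matrix ι ι ℂ) * (U : Matrix ι ι ℂ)ᴴ = 1 :=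
      Matrix.mem_unitaryGroup_iff.mp U.2
    rw [Matrix.mem_unitaryGroup_iff, Matrix.star_eq_conjTranspose, tensorMat_conjTranspose,
      tensorMat_mul, hU, tensorMat_one]⟩
  map_one' := Subtype.ext tensorMat_one
  map_mul' _ _ := Subtype.ext (tensorMat_mul _ _).symm

/-! ### Qubits -/

/-- Index set of the computational basis of `N` qubits. -/
abbrev QubitIdx (N : ℕ) : Type := Fin N → Fin 2

/-- The unitary group `U_N` on `N` qubits. -/
abbrev QubitUnitary (N : ℕ) : Type := Matrix.unitaryGroup (QubitIdx N) ℂ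

/-- `M` blocks of `n` qubits are the same as `M * n` qubits: the `j`-th qubit of the `k`-th block
is the qubit `k * n + j`. -/
def blockEquiv (M n : ℕ) : (Fin M → QubitIdx n) ≃ QubitIdx (M * n) :=
  (Equiv.curry (Fin M) (Fin n) (Fin 2)).symm.trans
    (Equiv.arrowCongr finProdFinEquiv (Equiv.refl (Fin 2)))

/-- The homomorphism `F ↦ F^{⊗ M}` from unitaries on `n` qubits to unitaries on `M * n` qubits. -/
def collective (M n : ℕ) : QubitUnitary n →* QubitUnitary (M * n) where
  toFun F := ⟨Matrix.reindexAlgEquiv ℂ ℂ (blockEquiv M n) (tensorPow M F).1, by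
    have h : (tensorPow M F).1 * ((tensorPow M F).1)ᴴ = 1 :=
      Matrix.mem_unitaryGroup_iff.mp (tensorPow M F).2
    have h2 : star (Matrix.reindexAlgEquiv ℂ ℂ (blockEquiv M n) (tensorPow M F).1)
        = Matrix.reindexAlgEquiv ℂ ℂ (blockEquiv M n) ((tensorPow M F).1)ᴴ := by
      simp [Matrix.star_eq_conjTranspose, Matrix.coe_reindexAlgEquiv]
    rw [Matrix.mem_unitaryGroup_iff, h2, ← map_mul, h, map_one]⟩
  map_one' := Subtype.ext (by simp)
  map_mul' _ _ := Subtype.ext (by simp only [map_mul, Submonoid.coe_mul])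

/-- The group `{F^{⊗ M} | F ∈ 𝓕}`. -/
def collectiveGroup (M : ℕ) {n : ℕ} (𝓕 : Subgroup (QubitUnitary n)) :
    Subgroup (QubitUnitary (M * n)) :=
  𝓕.map (collective M n)

/-! ### The Pauli group and the Clifford group -/

/-- The single-qubit Pauli matrices `I, X, Y, Z`. -/
def pauliMat : Fin 4 → Matrix (Fin 2) (Fin 2) ℂ :=
  ![1, !![0, 1; 1, 0], !![0, -Complex.I; Complex.I, 0], !![1, 0; 0, -1]]

theorem pauliMat_conjTranspose (a : Fin 4) : (pauliMat a)ᴴ = pauliMat a := by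
  fin_cases a <;> ext i j <;> fin_cases i <;> fin_cases j <;> simp [pauliMat]

theorem pauliMat_mul_self (a : Fin 4) : pauliMat a * pauliMat a = 1 := by
  fin_cases a <;> ext i j <;> fin_cases i <;> fin_cases j <;>
    simp [pauliMat, Matrix.mul_apply, Fin.sum_univ_two]

theorem pauliMat_mul (a b : Fin 4) :
    ∃ (z : ℂ) (c : Fin 4), z ^ 4 = 1 ∧ pauliMat a * pauliMat b = z • pauliMat c := by
  have h1 : ((1 : ℂ)) ^ 4 = 1 := by norm_num
  have hI : Complex.I ^ 4 = 1 := Complex.I_pow_four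
  have hI' : (-Complex.I) ^ 4 = 1 := by rw [Even.neg_pow (by decide), hI]
  fin_cases a <;> fin_cases b
  · exact ⟨1, 0, h1, by simp [pauliMat]⟩
  · exact ⟨1, 1, h1, by simp [pauliMat]⟩
  · exact ⟨1, 2, h1, by simp [pauliMat]⟩
  · exact ⟨1, 3, h1, by simp [pauliMat]⟩
  · exact ⟨1, 1, h1, by simp [pauliMat]⟩
  · exact ⟨1, 0, h1, by simpa [pauliMat] using pauliMat_mul_self 1⟩
  · exact ⟨Complex.I, 3, hI, by simp [pauliMat]⟩
  · exact ⟨-Complex.I, 2, hI', by simp [pauliMat]⟩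
  · exact ⟨1, 2, h1, by simp [pauliMat]⟩
  · exact ⟨-Complex.I, 3, hI', by simp [pauliMat]⟩
  · exact ⟨1, 0, h1, by simpa [pauliMat] using pauliMat_mul_self 2⟩
  · exact ⟨Complex.I, 1, hI, by simp [pauliMat]⟩
  · exact ⟨1, 3, h1, by simp [pauliMat]⟩
  · exact ⟨Complex.I, 2, hI, by simp [pauliMat]⟩
  · exact ⟨-Complex.I, 1, hI', by simp [pauliMat]⟩
  · exact ⟨1, 0, h1, by simpa [pauliMat] using pauliMat_mul_self 3⟩

/-- The Pauli string `σ_{p 0} ⊗ ⋯ ⊗ σ_{p (N - 1)}`. -/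
def pauliString {N : ℕ} (p : Fin N → Fin 4) : Matrix (QubitIdx N) (QubitIdx N) ℂ :=
  tensorMat fun k => pauliMat (p k)

theorem pauliString_mul {N : ℕ} (p q : Fin N → Fin 4) :
    ∃ (z : ℂ) (r : Fin N → Fin 4), z ^ 4 = 1 ∧
      pauliString p * pauliString q = z • pauliString r := by
  choose z c hz hc using pauliMat_mul
  refine ⟨∏ k, z (p k) (q k), fun k => c (p k) (q k), ?_, ?_⟩
  · rw [← Finset.prod_pow]
    exact Finset.prod_eq_one fun k _ => hz _ _
  · rw [pauliString, pauliString, tensorMat_mul]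
    ext a b
    simp [tensorMat, hc, pauliString, Finset.prod_mul_distrib]

/-- The Pauli group `P_N = {± 1, ± i} · {I, X, Y, Z}^{⊗ N}`. -/
def pauliGroup (N : ℕ) : Subgroup (QubitUnitary N) where
  carrier := {U | ∃ (z : ℂ) (p : Fin N → Fin 4), z ^ 4 = 1 ∧
    (U : Matrix (QubitIdx N) (QubitIdx N) ℂ) = z • pauliString p}
  one_mem' := ⟨1, fun _ => 0, by norm_num, by
    simpa [pauliString, pauliMat] using tensorMat_one.symm⟩
  mul_mem' := by
    rintro U V ⟨z, p, hz, hU⟩ ⟨w, q, hw, hV⟩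
    obtain ⟨y, r, hy, hr⟩ := pauliString_mul p q
    refine ⟨z * w * y, r, by rw [mul_pow, mul_pow, hz, hw, hy]; norm_num, ?_⟩
    rw [Submonoid.coe_mul, hU, hV, Matrix.smul_mul, Matrix.mul_smul, hr, smul_smul, smul_smul,
      mul_assoc]
  inv_mem' := by
    rintro U ⟨z, p, hz, hU⟩
    refine ⟨star z, p, by rw [← star_pow, hz, star_one], ?_⟩
    have h : ((U⁻¹ : QubitUnitary N) : Matrix (QubitIdx N) (QubitIdx N) ℂ)
        = (U : Matrix (QubitIdx N) (QubitIdx N) ℂ)ᴴ := rfl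
    rw [h, hU, Matrix.conjTranspose_smul, pauliString, tensorMat_conjTranspose]
    simp only [pauliMat_conjTranspose]

/-- The Clifford group `C_N`, the normalizer of the Pauli group in `U_N`. -/
def cliffordGroup (N : ℕ) : Subgroup (QubitUnitary N) :=
  Subgroup.normalizer (pauliGroup N : Set (QubitUnitary N))

/-- The `𝒢`-symmetric unitary group `U_{N,𝒢}`: all unitaries commuting with every element
of `𝒢`. -/
def symUnitaryGroup {N : ℕ} (𝒢 : Subgroup (QubitUnitary N)) : Subgroup (QubitUnitary N) :=
  Subgroup.centralizer (𝒢 : Set (QubitUnitary N))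

/-- The `𝒢`-symmetric Clifford group `C_{N,𝒢} = C_N ∩ U_{N,𝒢}`. -/
def symCliffordGroup {N : ℕ} (𝒢 : Subgroup (QubitUnitary N)) : Subgroup (QubitUnitary N) :=
  cliffordGroup N ⊓ symUnitaryGroup 𝒢

/-! ### Compactness of the groups involved -/

instance unitaryGroup_compactSpace {ι : Type} [Fintype ι] [DecidableEq ι] :
    CompactSpace (Matrix.unitaryGroup ι ℂ) := by
  refine (isCompact_iff_compactSpace
    (s := (Matrix.unitaryGroup ι ℂ : Set (Matrix ι ι ℂ)))).mp ?_
  have hK : IsCompact (Set.univ.pi fun _ : ι => Set.univ.pi fun _ : ι =>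
      Metric.closedBall (0 : ℂ) 1) :=
    isCompact_univ_pi fun _ => isCompact_univ_pi fun _ => isCompact_closedBall 0 1
  have hc : IsClosed (Matrix.unitaryGroup ι ℂ : Set (Matrix ι ι ℂ)) := by
    have : (Matrix.unitaryGroup ι ℂ : Set (Matrix ι ι ℂ)) = {A | A * star A = 1} := by
      ext A
      exact Matrix.mem_unitaryGroup_iff
    rw [this]
    exact isClosed_eq (continuous_id.mul continuous_star) continuous_const
  refine IsCompact.of_isClosed_subset (X := Matrix ι ι ℂ) hK hc ?_
  intro A hA i _ j _
  simpa using entry_norm_bound_of_unitary hA i j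

theorem pauliGroup_finite (N : ℕ) : (pauliGroup N : Set (QubitUnitary N)).Finite := by
  have hz : {z : ℂ | z ^ 4 = 1}.Finite := by
    refine (Polynomial.nthRoots 4 (1 : ℂ)).toFinset.finite_toSet.subset fun z hz => ?_
    simpa [Polynomial.mem_nthRoots] using hz
  refine Set.Finite.of_finite_image (f := Subtype.val) ?_ Subtype.val_injective.injOn
  refine ((hz.prod (Set.finite_univ (α := Fin N → Fin 4))).image
    fun x => x.1 • pauliString x.2).subset ?_
  rintro _ ⟨U, ⟨z, p, hz, hU⟩, rfl⟩
  exact ⟨(z, p), ⟨hz, trivial⟩, hU.symm⟩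

theorem isClosed_symUnitaryGroup {N : ℕ} (𝒢 : Subgroup (QubitUnitary N)) :
    IsClosed (symUnitaryGroup 𝒢 : Set (QubitUnitary N)) := by
  have : (symUnitaryGroup 𝒢 : Set (QubitUnitary N)) = ⋂ G ∈ 𝒢, {U | G * U = U * G} := by
    ext U
    simp [symUnitaryGroup, Subgroup.mem_centralizer_iff]
  rw [this]
  exact isClosed_biInter fun G _ =>
    isClosed_eq (continuous_const.mul continuous_id) (continuous_id.mul continuous_const)

theorem isClosed_cliffordGroup (N : ℕ) :
    IsClosed (cliffordGroup N : Set (QubitUnitary N)) := by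
  have hP : IsClosed (pauliGroup N : Set (QubitUnitary N)) := (pauliGroup_finite N).isClosed
  have : (cliffordGroup N : Set (QubitUnitary N)) =
      (⋂ P ∈ pauliGroup N, {U | U * P * U⁻¹ ∈ pauliGroup N}) ∩
      (⋂ P ∈ pauliGroup N, {U | U⁻¹ * P * U ∈ pauliGroup N}) := by
    ext U
    simp only [cliffordGroup, SetLike.mem_coe, Subgroup.mem_normalizer_iff, Set.mem_inter_iff,
      Set.mem_iInter, Set.mem_ofPred_eq]
    refine ⟨fun h => ⟨fun P hP => (h P).1 hP, fun P hP => (h _).2 ?_⟩,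
      fun h P => ⟨h.1 P, fun hP => ?_⟩⟩
    · have e : U * (U⁻¹ * P * U) * U⁻¹ = P := by group
      rwa [e]
    · have e : U⁻¹ * (U * P * U⁻¹) * U = P := by group
      simpa [e] using h.2 _ hP
  rw [this]
  refine (isClosed_biInter fun P _ => hP.preimage ?_).inter
    (isClosed_biInter fun P _ => hP.preimage ?_)
  · exact (continuous_id.mul continuous_const).mul continuous_inv
  · exact (continuous_inv.mul continuous_const).mul continuous_id

instance symUnitaryGroup_compactSpace {N : ℕ} (𝒢 : Subgroup (QubitUnitary N)) :
    CompactSpace (symUnitaryGroup 𝒢) :=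
  isCompact_iff_compactSpace.mp (isClosed_symUnitaryGroup 𝒢).isCompact

instance symCliffordGroup_compactSpace {N : ℕ} (𝒢 : Subgroup (QubitUnitary N)) :
    CompactSpace (symCliffordGroup 𝒢) :=
  isCompact_iff_compactSpace.mp
    ((isClosed_cliffordGroup N).inter (isClosed_symUnitaryGroup 𝒢)).isCompact

/-! ### Twirling channels and symmetric unitary designs -/

instance unitaryGroup_measurableSpace {ι : Type} [Fintype ι] [DecidableEq ι] :
    MeasurableSpace (Matrix.unitaryGroup ι ℂ) := borel _

instance unitaryGroup_borelSpace {ι : Type} [Fintype ι] [DecidableEq ι] :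
    BorelSpace (Matrix.unitaryGroup ι ℂ) := ⟨rfl⟩

/-- The normalized Haar measure on a compact subgroup `𝒳` of `U_N`. -/
def normalizedHaar {N : ℕ} (𝒳 : Subgroup (QubitUnitary N)) [CompactSpace 𝒳] :
    MeasureTheory.Measure 𝒳 :=
  MeasureTheory.Measure.haarMeasure ⊤

/-- The `t`-fold conjugation `L ↦ U^{⊗ t} L U^{† ⊗ t}`. -/
def conjTensor {N : ℕ} (t : ℕ) (U : QubitUnitary N)
    (L : Matrix (Fin t → QubitIdx N) (Fin t → QubitIdx N) ℂ) :
    Matrix (Fin t → QubitIdx N) (Fin t → QubitIdx N) ℂ :=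
  (tensorPow t U).1 * L * ((tensorPow t U).1)ᴴ

/-- The `t`-fold twirling channel `Φ_{t,𝒳}`, the matrix-valued Haar integral being taken
entry by entry. -/
def twirl {N : ℕ} (t : ℕ) (𝒳 : Subgroup (QubitUnitary N)) [CompactSpace 𝒳]
    (L : Matrix (Fin t → QubitIdx N) (Fin t → QubitIdx N) ℂ) :
    Matrix (Fin t → QubitIdx N) (Fin t → QubitIdx N) ℂ :=
  Matrix.of fun a b => ∫ U : 𝒳, conjTensor t (U : QubitUnitary N) L a b ∂(normalizedHaar 𝒳)

/-- `𝒳` is a `𝒢`-symmetric unitary `t`-design: `Φ_{t,𝒳} = Φ_{t,U_{N,𝒢}}`. -/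
def IsSymmetricUnitaryDesign {N : ℕ} (t : ℕ) (𝒢 𝒳 : Subgroup (QubitUnitary N))
    [CompactSpace 𝒳] : Prop :=
  twirl t 𝒳 = twirl t (symUnitaryGroup 𝒢)

/-! ### Connected Lie subgroups -/

/-- `𝓕` is a connected Lie subgroup of `U(ι)`: it is the image of a connected (finite-dimensional,
smooth) Lie group under a homomorphism that is an injective smooth immersion.  Smoothness and
derivatives are computed in the ambient real vector space `ι → ι → ℂ` of matrices, of which the
unitary group is an embedded submanifold. The subgroup need not be closed. -/
def IsConnectedLieSubgroup {ι : Type} [Fintype ι] [DecidableEq ι]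
    (𝓕 : Subgroup (Matrix.unitaryGroup ι ℂ)) : Prop :=
  ∃ (d : ℕ) (L : Type) (_ : Group L) (_ : TopologicalSpace L)
    (_ : ChartedSpace (EuclideanSpace ℝ (Fin d)) L)
    (_ : LieGroup 𝓘(ℝ, EuclideanSpace ℝ (Fin d)) ∞ L) (_ : ConnectedSpace L)
    (φ : L →* Matrix.unitaryGroup ι ℂ),
    φ.range = 𝓕 ∧ Function.Injective φ ∧
    ContMDiff 𝓘(ℝ, EuclideanSpace ℝ (Fin d)) 𝓘(ℝ, ι → ι → ℂ) ∞
      (fun (g : L) (i j : ι) => (φ g : Matrix ι ι ℂ) i j) ∧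
    ∀ g : L, Function.Injective
      (mfderiv 𝓘(ℝ, EuclideanSpace ℝ (Fin d)) 𝓘(ℝ, ι → ι → ℂ)
        (fun (g : L) (i j : ι) => (φ g : Matrix ι ι ℂ) i j) g)

end

/-!
The argument is elementary; all that is used of the Lie group structure is that `𝓕` is a continuous
image of a connected space. Write `f_p(F) = tr (P_p F)` for the Pauli coefficients of `F ∈ 𝓕`.

*A symmetric design forces scalars.* The quantity `tr (P_s U P_r U†)` is real, and its square is a
matrix element of `U ↦ U^{⊗ 2} (·) U^{† ⊗ 2}`, so its mean over the symmetric Clifford group equals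
its mean over the symmetric unitary group. Hence, if some symmetric unitary `U` gives it a nonzero
value, then some symmetric Clifford unitary `V` satisfies `V P_r V† = z P_s`
(`exists_symClifford_conj_eq_of_overlap`), and since `V` commutes with `F^{⊗ M}`, the coefficients
of `F^{⊗ M}` at `P_r` and `P_s` have the same modulus. Let `Q` anticommute with `P`. The square root
of the swap of two blocks is a symmetric unitary that makes `P ⊗ 1` overlap with `QP ⊗ Q`
(`trace_sqrtSwap_conj_ne_zero`). As `F^{⊗ M}` is a product operator, this yields
`|f_P| |f_1| = |f_{QP}| |f_Q|` whenever `f_1 ≠ 0` (`exists_norm_trace_mul_eq`). If `|f_1|` strictly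
dominates all other coefficients, applying this to a largest one of them shows that they all vanish.
So "`F` is scalar" is both a closed and an open condition on `𝓕`, and connectedness concludes
(`exists_eq_smul_one_of_design`).

*The Clifford group is a 2-design.* An operator commuting with all `R ⊗ R` for Pauli `R` is a
combination of the `P ⊗ P`. For anticommuting `P` and `Q` the Clifford unitary `(P + Q) / √2`
exchanges `P` and `Q`, so an operator commuting with all `V ⊗ V` for Clifford `V` has the same
coefficient at all `P ≠ 1` and is a combination of the identity and the swap
(`exists_eq_one_add_swap_of_clifford_invariant`). A twirl over any compact group containing the
Clifford group takes values there and preserves the pairings with the identity and the swap, which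
determines it (`twirl_two_eq_of_clifford_le`).

Finally, a unitary commuting with all Pauli strings is scalar (`symUnitaryGroup_eq_top_iff`).
-/

/-! ### Traces and tensor products -/

theorem trace_tensorMat {ι : Type} [Fintype ι] {t : ℕ} (A : Fin t → Matrix ι ι ℂ) :
    (tensorMat A).trace = ∏ k, (A k).trace := by
  classical
  simp only [Matrix.trace, Matrix.diag, tensorMat, Matrix.of_apply]
  rw [Finset.prod_univ_sum, Fintype.piFinset_univ]

theorem tensorMat_smul {ι : Type} {t : ℕ} (c : Fin t → ℂ) (A : Fin t → Matrix ι ι ℂ) :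
    tensorMat (fun k => c k • A k) = (∏ k, c k) • tensorMat A := by
  ext a b
  simp [tensorMat, Finset.prod_mul_distrib]

/-- The family `E` of matrices satisfies the completeness relation
`∑ₓ Eₓ ⊗ Eₓ = c • SWAP`, written entry by entry. -/
def IsCompleteFamily {κ ι : Type} [Fintype κ] [DecidableEq ι]
    (E : κ → Matrix ι ι ℂ) (c : ℂ) : Prop :=
  ∀ i j k l, ∑ x, E x i j * E x k l = if i = l ∧ j = k then c else 0

theorem IsCompleteFamily.tensor {κ ι : Type} [Fintype κ] [DecidableEq κ] [DecidableEq ι]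
    {E : κ → Matrix ι ι ℂ} {c : ℂ} (h : IsCompleteFamily E c) (t : ℕ) :
    IsCompleteFamily (fun x : Fin t → κ => tensorMat fun k => E (x k)) (c ^ t) := by
  intro a b a' b'
  simp only [tensorMat, Matrix.of_apply, ← Finset.prod_mul_distrib]
  rw [← Fintype.piFinset_univ, ← Finset.prod_univ_sum (fun _ => Finset.univ)
    (fun k x => E x (a k) (b k) * E x (a' k) (b' k))]
  simp only [h _ _ _ _]
  split_ifs with hab
  · simp [hab.1, hab.2]
  · rw [not_and_or] at hab
    obtain ⟨k, hk⟩ : ∃ k, ¬ (a k = b' k ∧ b k = a' k) := by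
      by_contra! hall
      exact hab.elim (fun h1 => h1 (funext fun k => (hall k).1))
        (fun h2 => h2 (funext fun k => (hall k).2))
    exact Finset.prod_eq_zero (Finset.mem_univ k) (if_neg hk)

/-- The expansion of a matrix in a complete family. -/
theorem IsCompleteFamily.sum_trace_smul {κ ι : Type} [Fintype κ] [Fintype ι] [DecidableEq ι]
    {E : κ → Matrix ι ι ℂ} {c : ℂ} (h : IsCompleteFamily E c) (A : Matrix ι ι ℂ) :
    ∑ x, (E x * A).trace • E x = c • A := by
  ext k l
  simp only [Matrix.sum_apply, Matrix.smul_apply, smul_eq_mul, Matrix.trace, Matrix.diag,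
    Matrix.mul_apply, Finset.sum_mul]
  rw [Finset.sum_comm]
  have key : ∀ i j, ∑ x, E x i j * A j i * E x k l = if i = l ∧ j = k then c * A j i else 0 := by
    intro i j
    rw [← ite_zero_mul, ← h i j k l, Finset.sum_mul]
    exact Finset.sum_congr rfl fun x _ => by ring
  rw [Finset.sum_congr rfl fun i _ => Finset.sum_comm]
  simp only [key, ite_and]
  simp

/-! ### Pauli strings -/

theorem pauliString_conjTranspose {N : ℕ} (p : Fin N → Fin 4) :
    (pauliString p)ᴴ = pauliString p := by
  simp only [pauliString, tensorMat_conjTranspose, pauliMat_conjTranspose]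

theorem pauliString_mul_self {N : ℕ} (p : Fin N → Fin 4) :
    pauliString p * pauliString p = 1 := by
  simp only [pauliString, tensorMat_mul, pauliMat_mul_self, tensorMat_one]

theorem pauliString_mul_ne_zero {N : ℕ} (p q : Fin N → Fin 4) :
    pauliString p * pauliString q ≠ 0 := by
  intro h
  have h1 : pauliString p * (pauliString p * pauliString q) * pauliString q = 1 := by
    rw [← mul_assoc, pauliString_mul_self, one_mul, pauliString_mul_self]
  rw [h, mul_zero, zero_mul] at h1
  exact zero_ne_one h1

theorem pauliString_zero {N : ℕ} : pauliString (0 : Fin N → Fin 4) = 1 := by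
  simpa [pauliString, pauliMat] using tensorMat_one

theorem trace_pauliMat_mul (a b : Fin 4) :
    (pauliMat a * pauliMat b).trace = if a = b then 2 else 0 := by
  fin_cases a <;> fin_cases b <;>
    simp [pauliMat, Matrix.trace, Fin.sum_univ_two] <;> norm_num

theorem trace_pauliString_mul {N : ℕ} (p q : Fin N → Fin 4) :
    (pauliString p * pauliString q).trace = if p = q then 2 ^ N else 0 := by
  simp only [pauliString, tensorMat_mul, trace_tensorMat, trace_pauliMat_mul]
  split_ifs with h
  · simp [h]
  · obtain ⟨k, hk⟩ := Function.ne_iff.mp h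
    exact Finset.prod_eq_zero (Finset.mem_univ k) (if_neg hk)

theorem trace_pauliString {N : ℕ} {p : Fin N → Fin 4} (hp : p ≠ 0) :
    (pauliString p).trace = 0 := by
  simpa [pauliString_zero, hp] using trace_pauliString_mul p 0

theorem isCompleteFamily_pauliMat : IsCompleteFamily pauliMat 2 := by
  intro i j k l
  fin_cases i <;> fin_cases j <;> fin_cases k <;> fin_cases l <;>
    simp [pauliMat, Fin.sum_univ_four] <;> norm_num

theorem isCompleteFamily_pauliString (N : ℕ) :
    IsCompleteFamily (pauliString : (Fin N → Fin 4) → _) (2 ^ N) :=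
  isCompleteFamily_pauliMat.tensor N

theorem pauliMat_commute_or (a b : Fin 4) :
    ∃ s : ℂ, (s = 1 ∨ s = -1) ∧ pauliMat a * pauliMat b = s • (pauliMat b * pauliMat a) := by
  by_cases h : pauliMat a * pauliMat b = pauliMat b * pauliMat a
  · exact ⟨1, Or.inl rfl, by simpa using h⟩
  · refine ⟨-1, Or.inr rfl, ?_⟩
    revert h
    fin_cases a <;> fin_cases b <;> simp [pauliMat]

/-- Any two Pauli strings commute or anticommute. -/
theorem pauliString_commute_or {N : ℕ} (p q : Fin N → Fin 4) :
    pauliString p * pauliString q = pauliString q * pauliString p ∨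
      pauliString p * pauliString q = -(pauliString q * pauliString p) := by
  choose s hs hc using pauliMat_commute_or
  have h1 : pauliString p * pauliString q =
      (∏ k, s (p k) (q k)) • (pauliString q * pauliString p) := by
    simp only [pauliString, tensorMat_mul, ← tensorMat_smul, ← hc]
  have h2 : (∏ k, s (p k) (q k)) = 1 ∨ (∏ k, s (p k) (q k)) = -1 := by
    refine Finset.prod_induction _ (fun z : ℂ => z = 1 ∨ z = -1) ?_ (Or.inl rfl)
      fun k _ => hs _ _
    rintro x y (rfl | rfl) (rfl | rfl) <;> simp
  rcases h2 with h2 | h2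
  · left; rw [h1, h2, one_smul]
  · right; rw [h1, h2, neg_one_smul]

theorem exists_pauliMat_anticommute {a : Fin 4} (ha : a ≠ 0) :
    ∃ b, pauliMat a * pauliMat b = -(pauliMat b * pauliMat a) := by
  fin_cases a
  · exact absurd rfl ha
  · exact ⟨3, by simp [pauliMat]⟩
  · exact ⟨3, by simp [pauliMat]⟩
  · exact ⟨1, by simp [pauliMat]⟩

theorem exists_pauliString_anticommute {N : ℕ} {p : Fin N → Fin 4} (hp : p ≠ 0) :
    ∃ q : Fin N → Fin 4, pauliString p * pauliString q = -(pauliString q * pauliString p) := by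
  obtain ⟨k, hk⟩ := Function.ne_iff.mp hp
  obtain ⟨b, hb⟩ := exists_pauliMat_anticommute hk
  refine ⟨Pi.single k b, ?_⟩
  have h : (fun i => pauliMat (p i) * pauliMat ((Pi.single k b : Fin N → Fin 4) i)) =
      fun i => (if i = k then (-1 : ℂ) else 1) •
        (pauliMat ((Pi.single k b : Fin N → Fin 4) i) * pauliMat (p i)) := by
    funext i
    by_cases hi : i = k
    · subst hi; simpa using hb
    · simp [hi, pauliMat]
  rw [pauliString, pauliString, tensorMat_mul, tensorMat_mul, h, tensorMat_smul]
  simp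

theorem exists_pauliString_anticommute_both {N : ℕ} {p q : Fin N → Fin 4} (hp : p ≠ 0)
    (hq : q ≠ 0) :
    ∃ r : Fin N → Fin 4, pauliString p * pauliString r = -(pauliString r * pauliString p) ∧
      pauliString q * pauliString r = -(pauliString r * pauliString q) := by
  obtain ⟨u, hu⟩ := exists_pauliString_anticommute hp
  obtain ⟨v, hv⟩ := exists_pauliString_anticommute hq
  rcases pauliString_commute_or q u with hqu | hqu
  swap
  · exact ⟨u, hu, hqu⟩
  rcases pauliString_commute_or p v with hpv | hpv
  swap
  · exact ⟨v, hpv, hv⟩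
  -- Now `u` anticommutes only with `p` and `v` only with `q`, so their product serves.
  obtain ⟨z, r, hz, hr⟩ := pauliString_mul u v
  have hz0 : z ≠ 0 := by rintro rfl; norm_num at hz
  have hr' : pauliString r = z⁻¹ • (pauliString u * pauliString v) := by
    rw [hr, smul_smul, inv_mul_cancel₀ hz0, one_smul]
  refine ⟨r, ?_, ?_⟩ <;> rw [hr', Matrix.mul_smul, Matrix.smul_mul, ← smul_neg, ← mul_assoc]
  · rw [hu, neg_mul, mul_assoc, hpv, mul_assoc]
  · rw [hqu, mul_assoc, hv, mul_neg, mul_assoc]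

/-- A matrix orthogonal to all nontrivial Pauli strings is scalar. -/
theorem eq_smul_one_of_trace_pauliString {N : ℕ} {A : Matrix (QubitIdx N) (QubitIdx N) ℂ}
    (h : ∀ p : Fin N → Fin 4, p ≠ 0 → (pauliString p * A).trace = 0) :
    ∃ c : ℂ, A = c • 1 := by
  have hA := (isCompleteFamily_pauliString N).sum_trace_smul A
  rw [Finset.sum_eq_single 0 (fun p _ hp => by rw [h p hp, zero_smul]) (by simp),
    pauliString_zero] at hA
  refine ⟨(2 ^ N)⁻¹ * (1 * A).trace, ?_⟩
  rw [mul_smul, hA, smul_smul, inv_mul_cancel₀ (pow_ne_zero N two_ne_zero), one_smul]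

theorem trace_mul_eq_zero_of_anticommute {ι : Type} [Fintype ι] [DecidableEq ι]
    {P Q A : Matrix ι ι ℂ}
    (hQ : Q * Q = 1) (hPQ : P * Q = -(Q * P)) (hA : Q * A = A * Q) : (P * A).trace = 0 := by
  have h : (P * A).trace = -(P * A).trace := by
    calc (P * A).trace = (Q * Q * (P * A)).trace := by rw [hQ, one_mul]
      _ = (Q * P * A * Q).trace := by
          rw [mul_assoc, Matrix.trace_mul_comm]; simp only [mul_assoc]
      _ = (Q * P * Q * A).trace := by rw [mul_assoc, ← hA]; simp only [mul_assoc]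
      _ = -(P * A).trace := by
          rw [mul_assoc Q P Q, hPQ, mul_neg, ← mul_assoc, hQ, one_mul, neg_mul, Matrix.trace_neg]
  exact self_eq_neg.mp h

/-- Pauli strings, as unitaries. -/
def pauliUnitary {N : ℕ} (p : Fin N → Fin 4) : QubitUnitary N :=
  ⟨pauliString p, by
    rw [Matrix.mem_unitaryGroup_iff, Matrix.star_eq_conjTranspose, pauliString_conjTranspose,
      pauliString_mul_self]⟩

theorem pauliUnitary_mem {N : ℕ} (p : Fin N → Fin 4) : pauliUnitary p ∈ pauliGroup N :=
  ⟨1, p, by norm_num, by rw [one_smul]; rfl⟩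

theorem neg_mem_pauliGroup {N : ℕ} {U : QubitUnitary N} (hU : U ∈ pauliGroup N) :
    -U ∈ pauliGroup N := by
  obtain ⟨z, p, hz, h⟩ := hU
  exact ⟨-z, p, by rw [Even.neg_pow (by decide), hz], by rw [Unitary.coe_neg, h, neg_smul]⟩

/-! ### Permutations of tensor factors -/

/-- The unitary permuting the tensor factors of `(ℂ^ι)^{⊗ t}`, which sends the basis vector `b` to
the basis vector `b ∘ σ⁻¹`. -/
def tensorPerm (ι : Type) [DecidableEq ι] {t : ℕ} (σ : Equiv.Perm (Fin t)) :
    Matrix (Fin t → ι) (Fin t → ι) ℂ :=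
  Matrix.of fun a b => if a ∘ σ = b then 1 else 0

section tensorPerm

variable {ι : Type} [DecidableEq ι] {t : ℕ}

theorem tensorPerm_conjTranspose (σ : Equiv.Perm (Fin t)) :
    (tensorPerm ι σ)ᴴ = tensorPerm ι σ.symm := by
  ext a b
  simp only [Matrix.conjTranspose_apply, tensorPerm, Matrix.of_apply]
  have h : b ∘ σ = a ↔ a ∘ σ.symm = b := by rw [σ.comp_symm_eq, eq_comm]
  simp only [h]
  split_ifs <;> simp

variable [Fintype ι]

theorem tensorPerm_mul_apply (σ : Equiv.Perm (Fin t)) (X : Matrix (Fin t → ι) (Fin t → ι) ℂ)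
    (a b : Fin t → ι) : (tensorPerm ι σ * X) a b = X (a ∘ σ) b := by
  simp [Matrix.mul_apply, tensorPerm]

theorem mul_tensorPerm_apply (σ : Equiv.Perm (Fin t)) (X : Matrix (Fin t → ι) (Fin t → ι) ℂ)
    (a b : Fin t → ι) : (X * tensorPerm ι σ) a b = X a (b ∘ σ.symm) := by
  have h : ∀ c : Fin t → ι, c ∘ σ = b ↔ c = b ∘ σ.symm := fun c => (σ.eq_comp_symm c b).symm
  simp [Matrix.mul_apply, tensorPerm, h]

theorem tensorPerm_mul_tensorMat (σ : Equiv.Perm (Fin t)) (A : Fin t → Matrix ι ι ℂ) :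
    tensorPerm ι σ * tensorMat A = tensorMat (A ∘ σ.symm) * tensorPerm ι σ := by
  ext a b
  rw [tensorPerm_mul_apply, mul_tensorPerm_apply]
  simp only [tensorMat, Matrix.of_apply, Function.comp_apply]
  rw [← Equiv.prod_comp σ fun k => A (σ.symm k) (a k) (b (σ.symm k))]
  simp

theorem tensorPerm_mul_symm (σ : Equiv.Perm (Fin t)) :
    tensorPerm ι σ * tensorPerm ι σ.symm = 1 := by
  ext a b
  rw [tensorPerm_mul_apply]
  simp [tensorPerm, Matrix.one_apply, Function.comp_assoc]

theorem tensorPerm_swap_mul_self (i j : Fin t) :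
    tensorPerm ι (Equiv.swap i j) * tensorPerm ι (Equiv.swap i j) = 1 := by
  simpa using tensorPerm_mul_symm (ι := ι) (Equiv.swap i j)

/-- The swap trick `tr (SWAP (A ⊗ B)) = tr (A B)`, in the presence of further tensor factors. -/
theorem trace_tensorPerm_swap_mul {m : ℕ} (A : Fin (m + 2) → Matrix ι ι ℂ) :
    (tensorPerm ι (Equiv.swap 0 1) * tensorMat A).trace =
      (A 0 * A 1).trace * ∏ k : Fin m, (A k.succ.succ).trace := by
  have hentry : ∀ (x y : ι) (c : Fin m → ι),
      (tensorPerm ι (Equiv.swap 0 1) * tensorMat A : Matrix (Fin (m + 2) → ι) (Fin (m + 2) → ι) ℂ)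
        (Fin.cons x (Fin.cons y c)) (Fin.cons x (Fin.cons y c)) =
      A 0 y x * A 1 x y * ∏ k : Fin m, A k.succ.succ (c k) (c k) := fun x y c => by
    rw [tensorPerm_mul_apply, tensorMat, Matrix.of_apply, Fin.prod_univ_succ, Fin.prod_univ_succ,
      ← mul_assoc]
    have hs : ∀ k : Fin m, Equiv.swap (0 : Fin (m + 2)) 1 k.succ.succ = k.succ.succ := fun k =>
      Equiv.swap_apply_of_ne_of_ne (Fin.succ_ne_zero _)
        fun h => Fin.succ_ne_zero k (Fin.succ_injective _ h)
    simp only [Function.comp_apply, hs, Fin.succ_zero_eq_one, Equiv.swap_apply_left,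
      Equiv.swap_apply_right, Fin.cons_succ, Fin.cons_zero]
    simp only [← Fin.succ_zero_eq_one, Fin.cons_succ, Fin.cons_zero]
  have hprod : ∏ k : Fin m, (A k.succ.succ).trace =
      ∑ c : Fin m → ι, ∏ k : Fin m, A k.succ.succ (c k) (c k) := by
    simp only [Matrix.trace, Matrix.diag]
    rw [Finset.prod_univ_sum, Fintype.piFinset_univ]
  rw [hprod, Matrix.trace, ← (Fin.consEquiv fun _ => ι).sum_comp, Fintype.sum_prod_type]
  simp only [Matrix.diag]
  rw [Finset.sum_congr rfl fun x _ => ((Fin.consEquiv fun _ => ι).sum_comp _).symm]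
  simp only [Fintype.sum_prod_type, Fin.consEquiv, Equiv.coe_fn_mk, hentry, ← Finset.mul_sum,
    ← Finset.sum_mul]
  rw [Finset.sum_comm]
  simp [Matrix.trace, Matrix.mul_apply]

end tensorPerm

/-! ### The twirling channel -/

instance {N : ℕ} (𝒳 : Subgroup (QubitUnitary N)) [CompactSpace 𝒳] :
    MeasureTheory.IsProbabilityMeasure (normalizedHaar 𝒳) :=
  ⟨MeasureTheory.Measure.haarMeasure_self (K₀ := (⊤ : TopologicalSpace.PositiveCompacts 𝒳))⟩

instance {N : ℕ} (𝒳 : Subgroup (QubitUnitary N)) [CompactSpace 𝒳] :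
    (normalizedHaar 𝒳).IsHaarMeasure := by
  unfold normalizedHaar; infer_instance

theorem continuous_conjTensor {N : ℕ} (t : ℕ)
    (L : Matrix (Fin t → QubitIdx N) (Fin t → QubitIdx N) ℂ) :
    Continuous fun U : QubitUnitary N => conjTensor t U L := by
  have h : Continuous fun U : QubitUnitary N => (tensorPow t U).1 := by
    refine continuous_matrix fun a b => ?_
    simp only [tensorPow, tensorMat, MonoidHom.coe_mk, OneHom.coe_mk, Matrix.of_apply]
    exact continuous_finsetProd _ fun k _ => continuous_subtype_val.matrix_elem _ _
  unfold conjTensor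
  exact (h.mul continuous_const).mul h.matrix_conjTranspose

theorem trace_mul_twirl {N : ℕ} (t : ℕ) (𝒳 : Subgroup (QubitUnitary N)) [CompactSpace 𝒳]
    (B L : Matrix (Fin t → QubitIdx N) (Fin t → QubitIdx N) ℂ) :
    (B * twirl t 𝒳 L).trace =
      ∫ U : 𝒳, (B * conjTensor t (U : QubitUnitary N) L).trace ∂(normalizedHaar 𝒳) := by
  have hint : ∀ a b, MeasureTheory.Integrable
      (fun U : 𝒳 => conjTensor t (U : QubitUnitary N) L a b) (normalizedHaar 𝒳) := fun a b =>
    Continuous.integrable_of_hasCompactSupport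
      (((continuous_conjTensor t L).comp continuous_subtype_val).matrix_elem a b)
      (HasCompactSupport.of_compactSpace _)
  simp only [Matrix.trace, Matrix.diag, Matrix.mul_apply, twirl, Matrix.of_apply]
  refine Eq.symm ((MeasureTheory.integral_finsetSum _ fun a _ =>
    MeasureTheory.integrable_finsetSum _ fun b _ => (hint b a).const_mul (B a b)).trans ?_)
  refine Finset.sum_congr rfl fun a _ => ?_
  refine (MeasureTheory.integral_finsetSum _ fun b _ => (hint b a).const_mul (B a b)).trans ?_
  exact Finset.sum_congr rfl fun b _ => MeasureTheory.integral_const_mul _ _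

theorem conjTensor_mul {N t : ℕ} (U V : QubitUnitary N)
    (L : Matrix (Fin t → QubitIdx N) (Fin t → QubitIdx N) ℂ) :
    conjTensor t (U * V) L = conjTensor t U (conjTensor t V L) := by
  simp only [conjTensor, map_mul, Submonoid.coe_mul, Matrix.conjTranspose_mul, mul_assoc]

/-- The image of the twirling channel consists of operators invariant under the group, by left
invariance of the Haar measure. -/
theorem conjTensor_twirl {N t : ℕ} {𝒳 : Subgroup (QubitUnitary N)} [CompactSpace 𝒳]
    {V : QubitUnitary N} (hV : V ∈ 𝒳)
    (L : Matrix (Fin t → QubitIdx N) (Fin t → QubitIdx N) ℂ) :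
    conjTensor t V (twirl t 𝒳 L) = twirl t 𝒳 L := by
  refine Matrix.ext_iff_trace_mul_left.mpr fun B => ?_
  have key : ∀ X, (B * conjTensor t V X).trace =
      (((tensorPow t V).1)ᴴ * B * (tensorPow t V).1 * X).trace := fun X => by
    rw [conjTensor, ← mul_assoc, ← mul_assoc, Matrix.trace_mul_comm]
    simp only [mul_assoc]
  rw [key, trace_mul_twirl, trace_mul_twirl]
  simp only [← key, ← conjTensor_mul]
  exact MeasureTheory.integral_mul_left_eq_self
    (fun U : 𝒳 => (B * conjTensor t (U : QubitUnitary N) L).trace) (⟨V, hV⟩ : 𝒳)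

theorem conjTranspose_tensorPow_mul_self {N t : ℕ} (V : QubitUnitary N) :
    ((tensorPow t V).1)ᴴ * (tensorPow t V).1 = 1 :=
  Matrix.mem_unitaryGroup_iff'.mp (tensorPow t V).2

theorem conjTensor_eq_self_iff {N t : ℕ} {V : QubitUnitary N}
    {L : Matrix (Fin t → QubitIdx N) (Fin t → QubitIdx N) ℂ} :
    conjTensor t V L = L ↔ (tensorPow t V).1 * L = L * (tensorPow t V).1 := by
  constructor <;> intro h
  · conv_rhs => rw [← h]
    rw [conjTensor, mul_assoc _ _ (tensorPow t V).1, conjTranspose_tensorPow_mul_self, mul_one]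
  · rw [conjTensor, h, mul_assoc, ← Matrix.star_eq_conjTranspose,
      Matrix.mem_unitaryGroup_iff.mp (tensorPow t V).2, mul_one]

/-- Twirling does not change the pairing with an operator invariant under the group. -/
theorem trace_mul_twirl_of_commute {N t : ℕ} {𝒳 : Subgroup (QubitUnitary N)} [CompactSpace 𝒳]
    {B : Matrix (Fin t → QubitIdx N) (Fin t → QubitIdx N) ℂ}
    (hB : ∀ U ∈ 𝒳, B * (tensorPow t U).1 = (tensorPow t U).1 * B)
    (L : Matrix (Fin t → QubitIdx N) (Fin t → QubitIdx N) ℂ) :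
    (B * twirl t 𝒳 L).trace = (B * L).trace := by
  have h : ∀ U : 𝒳, (B * conjTensor t (U : QubitUnitary N) L).trace = (B * L).trace := fun U => by
    rw [conjTensor, ← mul_assoc, ← mul_assoc, Matrix.trace_mul_comm, hB U U.2, ← mul_assoc,
      ← mul_assoc, conjTranspose_tensorPow_mul_self, one_mul]
  rw [trace_mul_twirl]
  simp only [h]
  simp

/-! ### The Clifford group is a unitary 2-design -/

theorem inv_sqrt_two_mul_self : ((√2 : ℝ) : ℂ)⁻¹ * ((√2 : ℝ) : ℂ)⁻¹ = 2⁻¹ := by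
  rw [← mul_inv, ← Complex.ofReal_mul, Real.mul_self_sqrt zero_le_two, Complex.ofReal_ofNat]

/-- The unitary `(P + Q) / √2` for anticommuting Pauli strings `P` and `Q`, which exchanges the two
under conjugation. -/
noncomputable def pauliReflection {N : ℕ} (p q : Fin N → Fin 4)
    (h : pauliString p * pauliString q = -(pauliString q * pauliString p)) : QubitUnitary N :=
  ⟨((√2 : ℝ) : ℂ)⁻¹ • (pauliString p + pauliString q), by
    rw [Matrix.mem_unitaryGroup_iff, Matrix.star_eq_conjTranspose, Matrix.conjTranspose_smul,
      Matrix.conjTranspose_add, pauliString_conjTranspose, pauliString_conjTranspose,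
      Matrix.smul_mul, Matrix.mul_smul, smul_smul, add_mul, mul_add, mul_add,
      pauliString_mul_self, pauliString_mul_self, h, star_inv₀, Complex.star_def,
      Complex.conj_ofReal, inv_sqrt_two_mul_self]
    rw [show (1 : Matrix (QubitIdx N) (QubitIdx N) ℂ) + -(pauliString q * pauliString p) +
      (pauliString q * pauliString p + 1) = (2 : ℂ) • 1 by rw [two_smul]; abel, smul_smul]
    norm_num⟩

section pauliReflection

variable {N : ℕ} {p q : Fin N → Fin 4}
  (h : pauliString p * pauliString q = -(pauliString q * pauliString p))

theorem pauliReflection_inv : (pauliReflection p q h)⁻¹ = pauliReflection p q h := by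
  refine Subtype.ext ?_
  change star ((pauliReflection p q h) : Matrix (QubitIdx N) (QubitIdx N) ℂ) = _
  simp only [pauliReflection, Matrix.star_eq_conjTranspose, Matrix.conjTranspose_smul,
      Matrix.conjTranspose_add, pauliString_conjTranspose]
  simp

/-- The normalization of `(P + Q) / √2` drops out of conjugation. -/
theorem pauliReflection_mul_eq {V W : QubitUnitary N}
    (hVW : (pauliString p + pauliString q) * (V : Matrix (QubitIdx N) (QubitIdx N) ℂ) =
      W * (pauliString p + pauliString q)) :
    pauliReflection p q h * V * (pauliReflection p q h)⁻¹ = W := by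
  rw [mul_inv_eq_iff_eq_mul]
  refine Subtype.ext ?_
  simp only [Submonoid.coe_mul, pauliReflection, Matrix.smul_mul, Matrix.mul_smul, hVW]

theorem pauliReflection_conj :
    pauliReflection p q h * pauliUnitary p * (pauliReflection p q h)⁻¹ = pauliUnitary q := by
  refine pauliReflection_mul_eq h ?_
  simp only [pauliUnitary, add_mul, mul_add, pauliString_mul_self]
  abel

theorem pauliReflection_conj_mem {V : QubitUnitary N} (hV : V ∈ pauliGroup N) :
    pauliReflection p q h * V * (pauliReflection p q h)⁻¹ ∈ pauliGroup N := by
  have hV' := hV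
  obtain ⟨z, s, -, hs⟩ := hV'
  have hqpq : pauliString q * (pauliString p * pauliString q) = -pauliString p := by
    rw [h, mul_neg, ← mul_assoc, pauliString_mul_self, one_mul]
  have hPQ : pauliUnitary q * pauliUnitary p ∈ pauliGroup N :=
    mul_mem (pauliUnitary_mem q) (pauliUnitary_mem p)
  -- The result is `V` up to sign if `P` and `Q` have the same commutation sign with `V`, and
  -- `V Q P` up to sign otherwise.
  have hcomm : ∀ r : Fin N → Fin 4,
      pauliString r * (V : Matrix (QubitIdx N) (QubitIdx N) ℂ) = V * pauliString r ∨
      pauliString r * (V : Matrix (QubitIdx N) (QubitIdx N) ℂ) = -(V * pauliString r) := by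
    intro r
    rw [hs, Matrix.mul_smul, Matrix.smul_mul, ← smul_neg]
    exact (pauliString_commute_or r s).imp (congrArg _) (congrArg _)
  rcases hcomm p with hp | hp <;> rcases hcomm q with hq | hq
  · rwa [pauliReflection_mul_eq h (W := V) (by rw [add_mul, hp, hq, mul_add])]
  · rw [pauliReflection_mul_eq h (W := V * -(pauliUnitary q * pauliUnitary p))]
    · exact mul_mem hV (neg_mem_pauliGroup hPQ)
    · simp only [pauliUnitary, Submonoid.coe_mul, Unitary.coe_neg, add_mul, mul_add, hp, hq,
        mul_assoc, pauliString_mul_self, mul_neg, neg_mul, mul_one]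
      rw [hqpq, mul_neg, neg_neg, add_comm]
  · rw [pauliReflection_mul_eq h (W := V * (pauliUnitary q * pauliUnitary p))]
    · exact mul_mem hV hPQ
    · simp only [pauliUnitary, Submonoid.coe_mul, add_mul, mul_add, hp, hq, mul_assoc,
        pauliString_mul_self, mul_one]
      rw [hqpq, mul_neg, add_comm]
  · rw [pauliReflection_mul_eq h (W := -V) (by
      rw [add_mul, hp, hq, mul_add, Unitary.coe_neg, neg_mul, neg_mul])]
    exact neg_mem_pauliGroup hV

theorem pauliReflection_mem_cliffordGroup : pauliReflection p q h ∈ cliffordGroup N := by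
  rw [cliffordGroup, Subgroup.mem_normalizer_iff]
  refine fun V => ⟨pauliReflection_conj_mem h, fun hV => ?_⟩
  have := pauliReflection_conj_mem h hV
  rwa [show ∀ U : QubitUnitary N, U * (U * V * U⁻¹) * U⁻¹ = U * U * V * (U * U)⁻¹ from
    fun U => by group, mul_eq_one_iff_eq_inv.mpr (pauliReflection_inv h).symm, one_mul, inv_one,
    mul_one] at this

end pauliReflection

theorem Matrix.eq_zero_of_eq_neg {ι : Type} {A : Matrix ι ι ℂ} (h : A = -A) : A = 0 :=
  Matrix.ext fun i j => self_eq_neg.mp (congrFun (congrFun h i) j)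

theorem pauliUnitary_mem_cliffordGroup {N : ℕ} (p : Fin N → Fin 4) :
    pauliUnitary p ∈ cliffordGroup N :=
  Subgroup.le_normalizer (pauliUnitary_mem p)

/-- Distinct Pauli strings are told apart by a Pauli string that commutes with one of them and
anticommutes with the other; so `P ⊗ Q` anticommutes with some `R ⊗ R`. -/
theorem exists_anticommute_tensor {N : ℕ} {p : Fin 2 → Fin N → Fin 4} (hp : p 0 ≠ p 1) :
    ∃ r : Fin N → Fin 4, tensorMat (fun k => pauliString (p k)) * (tensorPow 2 (pauliUnitary r)).1 =
      -((tensorPow 2 (pauliUnitary r)).1 * tensorMat (fun k => pauliString (p k))) := by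
  obtain ⟨z, s, hz, hs⟩ := pauliString_mul (p 0) (p 1)
  have hz0 : z ≠ 0 := by rintro rfl; norm_num at hz
  have hs0 : s ≠ 0 := by
    rintro rfl
    have := congrArg Matrix.trace hs
    rw [trace_pauliString_mul, if_neg hp, pauliString_zero, Matrix.trace_smul,
      Matrix.trace_one] at this
    simp [hz0] at this
  obtain ⟨r, hr⟩ := exists_pauliString_anticommute hs0
  refine ⟨r, ?_⟩
  have hr' : pauliString (p 0) * pauliString (p 1) * pauliString r =
      -(pauliString r * (pauliString (p 0) * pauliString (p 1))) := by
    rw [hs, Matrix.mul_smul, Matrix.smul_mul, hr, smul_neg]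
  have hne' : pauliString r * (pauliString (p 0) * pauliString (p 1)) ≠ 0 := by
    rw [hs, Matrix.mul_smul]; exact smul_ne_zero hz0 (pauliString_mul_ne_zero r s)
  have htensor : ∀ c : Fin 2 → ℂ,
      (∀ k, pauliString (p k) * pauliString r = c k • (pauliString r * pauliString (p k))) →
      c 0 * c 1 = -1 → tensorMat (fun k => pauliString (p k)) * (tensorPow 2 (pauliUnitary r)).1 =
      -((tensorPow 2 (pauliUnitary r)).1 * tensorMat (fun k => pauliString (p k))) := by
    intro c hc hc1
    simp only [tensorPow, MonoidHom.coe_mk, OneHom.coe_mk, pauliUnitary, tensorMat_mul, hc,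
      tensorMat_smul, Fin.prod_univ_two, hc1, neg_one_smul]
  rcases pauliString_commute_or (p 0) r with h0 | h0 <;>
    rcases pauliString_commute_or (p 1) r with h1 | h1
  · rw [mul_assoc, h1, ← mul_assoc, h0, mul_assoc] at hr'
    exact absurd (Matrix.eq_zero_of_eq_neg hr') hne'
  · exact htensor ![1, -1] (by simp [Fin.forall_fin_two, h0, h1]) (by simp)
  · exact htensor ![-1, 1] (by simp [Fin.forall_fin_two, h0, h1]) (by simp)
  · rw [mul_assoc, h1, mul_neg, ← mul_assoc, h0, neg_mul, neg_neg, mul_assoc] at hr'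
    exact absurd (Matrix.eq_zero_of_eq_neg hr') hne'

/-- The coefficient of `P ⊗ P` in a Clifford-invariant operator is the same for all nontrivial `P`:
any two nontrivial Pauli strings are linked by one that anticommutes with both. -/
theorem exists_trace_eq_of_clifford_invariant {N : ℕ}
    {L : Matrix (Fin 2 → QubitIdx N) (Fin 2 → QubitIdx N) ℂ}
    (hL : ∀ V ∈ cliffordGroup N, (tensorPow 2 V).1 * L = L * (tensorPow 2 V).1) :
    ∃ c : ℂ, ∀ p : Fin N → Fin 4, p ≠ 0 →
      (tensorMat (fun _ => pauliString p) * L).trace = c := by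
  have hanti : ∀ p q : Fin N → Fin 4,
      pauliString p * pauliString q = -(pauliString q * pauliString p) →
      (tensorMat (fun _ => pauliString p) * L).trace =
        (tensorMat (fun _ => pauliString q) * L).trace := by
    intro p q h
    have hU := hL _ (pauliReflection_mem_cliffordGroup h)
    have hconj := congrArg (fun U => (tensorPow 2 U).1)
      (mul_inv_eq_iff_eq_mul.mp (pauliReflection_conj h))
    simp only [map_mul, Submonoid.coe_mul] at hconj
    set U := tensorPow 2 (pauliReflection p q h) with hUdef
    have hUU : U.1 * U.1ᴴ = 1 := Matrix.mem_unitaryGroup_iff.mp U.2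
    calc ((tensorPow 2 (pauliUnitary p)).1 * L).trace
        = ((tensorPow 2 (pauliUnitary p)).1 * L * (U.1ᴴ * U.1)).trace := by
          rw [conjTranspose_tensorPow_mul_self, mul_one]
      _ = (U.1 * (tensorPow 2 (pauliUnitary p)).1 * L * U.1ᴴ).trace := by
          rw [← mul_assoc, Matrix.trace_mul_comm]; simp only [mul_assoc]
      _ = ((tensorPow 2 (pauliUnitary q)).1 * L).trace := by
          rw [hconj, mul_assoc _ U.1, hU, mul_assoc, mul_assoc, hUU, mul_one]
  by_cases h : ∃ q : Fin N → Fin 4, q ≠ 0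
  · obtain ⟨q, hq⟩ := h
    refine ⟨(tensorMat (fun _ => pauliString q) * L).trace, fun p hp => ?_⟩
    obtain ⟨r, hpr, hqr⟩ := exists_pauliString_anticommute_both hp hq
    exact (hanti p r hpr).trans (hanti q r hqr).symm
  · exact ⟨0, fun p hp => absurd ⟨p, hp⟩ h⟩

/-- The commutant of the operators `V ⊗ V`, with `V` a Clifford unitary, is spanned by the identity
and the swap. -/
theorem exists_eq_one_add_swap_of_clifford_invariant {N : ℕ}
    {L : Matrix (Fin 2 → QubitIdx N) (Fin 2 → QubitIdx N) ℂ}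
    (hL : ∀ V ∈ cliffordGroup N, (tensorPow 2 V).1 * L = L * (tensorPow 2 V).1) :
    ∃ α β : ℂ, L = α • 1 + β • tensorPerm (QubitIdx N) (Equiv.swap (0 : Fin 2) 1) := by
  have hoff : ∀ p : Fin 2 → Fin N → Fin 4, p 0 ≠ p 1 →
      (tensorMat (fun k => pauliString (p k)) * L).trace = 0 := by
    intro p hp
    obtain ⟨r, hr⟩ := exists_anticommute_tensor hp
    refine trace_mul_eq_zero_of_anticommute ?_ hr (hL _ (pauliUnitary_mem_cliffordGroup r))
    simp only [tensorPow, MonoidHom.coe_mk, OneHom.coe_mk, pauliUnitary, tensorMat_mul,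
      pauliString_mul_self, tensorMat_one]
  obtain ⟨c, hc⟩ := exists_trace_eq_of_clifford_invariant hL
  have hsum := ((isCompleteFamily_pauliString N).tensor 2).sum_trace_smul L
  have hswap : ∑ p : Fin N → Fin 4, tensorMat (fun _ : Fin 2 => pauliString p) =
      (2 ^ N : ℂ) • tensorPerm (QubitIdx N) (Equiv.swap (0 : Fin 2) 1) := by
    ext a b
    have h := isCompleteFamily_pauliString N (a 0) (b 0) (a 1) (b 1)
    simp only [Matrix.sum_apply, tensorMat, Matrix.of_apply, Fin.prod_univ_two, h,
      Matrix.smul_apply, tensorPerm, funext_iff, Fin.forall_fin_two, Function.comp_apply,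
      Equiv.swap_apply_left, Equiv.swap_apply_right, smul_eq_mul, mul_ite, mul_one, mul_zero]
    congr 1
    simp only [← funext_iff]
    rw [and_comm, eq_comm (a := b 0)]
  have hdiag : ∑ p : Fin 2 → Fin N → Fin 4, (tensorMat (fun k => pauliString (p k)) * L).trace •
      tensorMat (fun k => pauliString (p k)) =
      ∑ p : Fin N → Fin 4, (tensorMat (fun _ : Fin 2 => pauliString p) * L).trace •
        tensorMat (fun _ : Fin 2 => pauliString p) := by
    symm
    refine Finset.sum_of_injOn (fun p _ => p) ?_ ?_ ?_ ?_
    · exact fun p _ q _ hpq => congrFun hpq 0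
    · simp
    · intro p _ hp
      rw [hoff p, zero_smul]
      intro h01
      refine hp ⟨p 0, by simp, ?_⟩
      funext k
      fin_cases k
      · rfl
      · exact h01
    · simp
  have hterm : ∀ p : Fin N → Fin 4, (tensorMat (fun _ : Fin 2 => pauliString p) * L).trace •
      tensorMat (fun _ : Fin 2 => pauliString p) =
      (if p = 0 then ((1 * L).trace - c) • 1 else 0) +
        c • tensorMat (fun _ : Fin 2 => pauliString p) := by
    intro p
    split_ifs with hp
    · rw [hp, pauliString_zero, tensorMat_one, ← add_smul, sub_add_cancel]
    · rw [hc p hp, zero_add]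
  have hne : ((2 : ℂ) ^ N) ^ 2 ≠ 0 := pow_ne_zero _ (pow_ne_zero _ two_ne_zero)
  rw [hdiag, Finset.sum_congr rfl fun p _ => hterm p, Finset.sum_add_distrib, ← Finset.smul_sum,
    hswap] at hsum
  simp only [Finset.sum_ite_eq', Finset.mem_univ, if_true] at hsum
  refine ⟨(((2 : ℂ) ^ N) ^ 2)⁻¹ * ((1 * L).trace - c), (((2 : ℂ) ^ N) ^ 2)⁻¹ * (c * 2 ^ N), ?_⟩
  rw [mul_smul, mul_smul, mul_smul, ← smul_add, hsum, smul_smul, inv_mul_cancel₀ hne, one_smul]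

open scoped ComplexOrder in
/-- The twirling channel of a compact group containing the Clifford group does not depend on the
group. -/
theorem twirl_two_eq_of_clifford_le {N : ℕ} {𝒳 𝒴 : Subgroup (QubitUnitary N)} [CompactSpace 𝒳]
    [CompactSpace 𝒴] (hX : cliffordGroup N ≤ 𝒳) (hY : cliffordGroup N ≤ 𝒴) :
    twirl 2 𝒳 = twirl 2 𝒴 := by
  funext L
  set W := tensorPerm (QubitIdx N) (Equiv.swap (0 : Fin 2) 1) with hW
  have hinv : ∀ (𝒵 : Subgroup (QubitUnitary N)) [CompactSpace 𝒵], cliffordGroup N ≤ 𝒵 →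
      ∀ V ∈ cliffordGroup N, (tensorPow 2 V).1 * twirl 2 𝒵 L = twirl 2 𝒵 L * (tensorPow 2 V).1 :=
    fun 𝒵 _ hZ V hV => conjTensor_eq_self_iff.mp (conjTensor_twirl (hZ hV) L)
  have hWcomm : ∀ U : QubitUnitary N, W * (tensorPow 2 U).1 = (tensorPow 2 U).1 * W := fun U =>
    tensorPerm_mul_tensorMat _ _
  -- Both twirls preserve the pairings with `1` and `W`, which commute with all `U ⊗ U`.
  have htr : ∀ B ∈ ({1, W} : Set _), (B * (twirl 2 𝒳 L - twirl 2 𝒴 L)).trace = 0 := by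
    rintro B (rfl | rfl)
    · rw [mul_sub, Matrix.trace_sub,
        trace_mul_twirl_of_commute (fun _ _ => by rw [one_mul, mul_one]),
        trace_mul_twirl_of_commute (fun _ _ => by rw [one_mul, mul_one]), sub_self]
    · rw [mul_sub, Matrix.trace_sub, trace_mul_twirl_of_commute (fun U _ => hWcomm U),
        trace_mul_twirl_of_commute (fun U _ => hWcomm U), sub_self]
  obtain ⟨α, β, h⟩ := exists_eq_one_add_swap_of_clifford_invariant
    (L := twirl 2 𝒳 L - twirl 2 𝒴 L) fun V hV => by
      rw [mul_sub, sub_mul, hinv 𝒳 hX V hV, hinv 𝒴 hY V hV]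
  -- The difference `D` lies in the span of `1` and `W` and is orthogonal to both, so
  -- `tr (D† D) = 0`.
  refine sub_eq_zero.mp (Matrix.trace_conjTranspose_mul_self_eq_zero_iff.mp ?_)
  nth_rewrite 1 [h]
  rw [Matrix.conjTranspose_add, Matrix.conjTranspose_smul, Matrix.conjTranspose_smul,
    Matrix.conjTranspose_one, tensorPerm_conjTranspose, Equiv.symm_swap, ← hW, add_mul,
    Matrix.smul_mul, Matrix.smul_mul, Matrix.trace_add, Matrix.trace_smul, Matrix.trace_smul,
    htr 1 (by simp), htr W (by simp), smul_zero, smul_zero, add_zero]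

/-! ### Clifford orbits of Pauli strings under a symmetric 2-design -/

section design

variable {N : ℕ}

/-- The overlap of a Pauli string with a rotated one is real, and its square is linear in the
two-fold conjugation. -/
theorem trace_pauliString_conj_sq (r s : Fin N → Fin 4) (U : QubitUnitary N) :
    (tensorMat (fun _ : Fin 2 => pauliString s) *
        conjTensor 2 U (tensorMat fun _ => pauliString r)).trace =
      ((((pauliString s * (U.1 * pauliString r * U.1ᴴ)).trace.re ^ 2 : ℝ)) : ℂ) := by
  have hre : (starRingEnd ℂ) (pauliString s * (U.1 * pauliString r * U.1ᴴ)).trace =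
      (pauliString s * (U.1 * pauliString r * U.1ᴴ)).trace := by
    rw [← Complex.star_def, ← Matrix.trace_conjTranspose, Matrix.conjTranspose_mul,
      Matrix.trace_mul_comm]
    simp only [Matrix.conjTranspose_mul, Matrix.conjTranspose_conjTranspose,
      pauliString_conjTranspose, mul_assoc]
  rw [Complex.ofReal_pow, Complex.conj_eq_iff_re.mp hre]
  simp only [conjTensor, tensorPow, MonoidHom.coe_mk, OneHom.coe_mk, tensorMat_conjTranspose,
    tensorMat_mul, trace_tensorMat, Fin.prod_univ_two, sq]

/-- In a symmetric 2-design, a Pauli string with nonzero overlap with a symmetric rotation of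
another one is already reached from it by a symmetric Clifford unitary: the second moments of the
overlap agree, and distinct Pauli strings are orthogonal. -/
theorem exists_symClifford_conj_eq_of_overlap {𝒢 : Subgroup (QubitUnitary N)}
    (hd : IsSymmetricUnitaryDesign 2 𝒢 (symCliffordGroup 𝒢)) {r s : Fin N → Fin 4}
    {U : QubitUnitary N} (hU : U ∈ symUnitaryGroup 𝒢)
    (hne : (pauliString s * (U.1 * pauliString r * U.1ᴴ)).trace ≠ 0) :
    ∃ V ∈ symCliffordGroup 𝒢, ∃ z : ℂ, z ^ 4 = 1 ∧
      V.1 * pauliString r * V.1ᴴ = z • pauliString s := by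
  by_contra! hcon
  set f : QubitUnitary N → ℂ :=
    fun U => (pauliString s * (U.1 * pauliString r * U.1ᴴ)).trace with hf
  have hzero : ∀ V : symCliffordGroup 𝒢, f V = 0 := by
    intro V
    have hmem : V.1 * pauliUnitary r * V.1⁻¹ ∈ pauliGroup N :=
      (Subgroup.mem_normalizer_iff.mp V.2.1 _).mp (pauliUnitary_mem r)
    obtain ⟨z, u, hz, hu⟩ := hmem
    have hu' : V.1.1 * pauliString r * V.1.1ᴴ = z • pauliString u := hu
    rw [hf]
    simp only [hu']
    rw [Matrix.mul_smul, Matrix.trace_smul, trace_pauliString_mul, if_neg, smul_zero]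
    rintro rfl
    exact hcon V.1 V.2 z hz hu'
  have hC := trace_mul_twirl 2 (symCliffordGroup 𝒢) (tensorMat (fun _ : Fin 2 => pauliString s))
    (tensorMat fun _ => pauliString r)
  rw [show twirl 2 (symCliffordGroup 𝒢) = twirl 2 (symUnitaryGroup 𝒢) from hd,
    trace_mul_twirl] at hC
  simp only [trace_pauliString_conj_sq, integral_complex_ofReal] at hC
  have hC0 : ∫ V : symCliffordGroup 𝒢, (f V).re ^ 2 ∂(normalizedHaar (symCliffordGroup 𝒢)) = 0 := by
    simp [hzero]
  rw [show (∫ V : symCliffordGroup 𝒢,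
    (pauliString s * (V.1.1 * pauliString r * V.1.1ᴴ)).trace.re ^ 2
    ∂(normalizedHaar (symCliffordGroup 𝒢))) = 0 from hC0] at hC
  have hcont : Continuous fun V : symUnitaryGroup 𝒢 => (f V).re ^ 2 := by
    have h1 : Continuous fun V : symUnitaryGroup 𝒢 => V.1.1 :=
      continuous_subtype_val.comp continuous_subtype_val
    exact (Complex.continuous_re.comp (continuous_const.mul
      ((h1.mul continuous_const).mul h1.matrix_conjTranspose)).matrix_trace).pow 2
  have hpos := hcont.integral_pos_of_hasCompactSupport_nonneg_nonzero
    (μ := normalizedHaar (symUnitaryGroup 𝒢)) (x := ⟨U, hU⟩) (HasCompactSupport.of_compactSpace _)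
    (fun V => sq_nonneg _) (by
      intro h0
      have h1 := trace_pauliString_conj_sq r s U
      rw [show (pauliString s * (U.1 * pauliString r * U.1ᴴ)).trace.re ^ 2 = 0 from h0] at h1
      simp only [conjTensor, tensorPow, MonoidHom.coe_mk, OneHom.coe_mk, tensorMat_conjTranspose,
        tensorMat_mul, trace_tensorMat, Fin.prod_univ_two, Complex.ofReal_zero,
        mul_self_eq_zero] at h1
      exact hne h1)
  exact hpos.ne' (Complex.ofReal_injective hC)

theorem norm_trace_pauliString_mul_eq_of_overlap {𝒢 : Subgroup (QubitUnitary N)}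
    (hd : IsSymmetricUnitaryDesign 2 𝒢 (symCliffordGroup 𝒢)) {r s : Fin N → Fin 4}
    {U : QubitUnitary N} (hU : U ∈ symUnitaryGroup 𝒢)
    (hne : (pauliString s * (U.1 * pauliString r * U.1ᴴ)).trace ≠ 0) {G : QubitUnitary N}
    (hG : G ∈ 𝒢) : ‖(pauliString r * G.1).trace‖ = ‖(pauliString s * G.1).trace‖ := by
  obtain ⟨V, hV, z, hz, h⟩ := exists_symClifford_conj_eq_of_overlap hd hU hne
  have hcomm : G.1 * V.1 = V.1 * G.1 :=
    congrArg Subtype.val (Subgroup.mem_centralizer_iff.mp hV.2 G hG)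
  have hVV : V.1ᴴ * V.1 = 1 := Matrix.mem_unitaryGroup_iff'.mp V.2
  have hz1 : ‖z‖ = 1 := by
    have := congrArg norm hz
    rw [norm_pow, norm_one] at this
    exact (pow_eq_one_iff_of_nonneg (norm_nonneg z) (by norm_num)).mp this
  have key : (pauliString r * G.1).trace = z * (pauliString s * G.1).trace := by
    calc (pauliString r * G.1).trace = (pauliString r * (V.1ᴴ * V.1 * G.1)).trace := by
          rw [hVV, one_mul]
      _ = (V.1 * pauliString r * V.1ᴴ * G.1).trace := by
          rw [mul_assoc V.1ᴴ, ← hcomm, ← mul_assoc, ← mul_assoc, Matrix.trace_mul_comm]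
          simp only [mul_assoc]
      _ = z * (pauliString s * G.1).trace := by
          rw [h, Matrix.smul_mul, Matrix.trace_smul, smul_eq_mul]
  rw [key, norm_mul, hz1, one_mul]

end design

/-! ### Collective symmetries -/

theorem reindex_tensorMat_pauliString {M n : ℕ} (p : Fin M → Fin n → Fin 4) :
    Matrix.reindexAlgEquiv ℂ ℂ (blockEquiv M n) (tensorMat fun k => pauliString (p k)) =
      pauliString fun j => p (finProdFinEquiv.symm j).1 (finProdFinEquiv.symm j).2 := by
  ext a b
  simp only [Matrix.coe_reindexAlgEquiv, Matrix.reindex_apply, Matrix.submatrix_apply,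
    pauliString, tensorMat, Matrix.of_apply]
  rw [← finProdFinEquiv.prod_comp, Fintype.prod_prod_type]
  simp [blockEquiv, Equiv.arrowCongr]

theorem trace_reindexAlgEquiv {M n : ℕ}
    (X : Matrix (Fin M → QubitIdx n) (Fin M → QubitIdx n) ℂ) :
    (Matrix.reindexAlgEquiv ℂ ℂ (blockEquiv M n) X).trace = X.trace := by
  simp only [Matrix.trace, Matrix.coe_reindexAlgEquiv, Matrix.reindex_apply, Matrix.diag,
    Matrix.submatrix_apply]
  exact (blockEquiv M n).symm.sum_comp fun a => X a a

theorem reindexAlgEquiv_conjTranspose {M n : ℕ}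
    (X : Matrix (Fin M → QubitIdx n) (Fin M → QubitIdx n) ℂ) :
    (Matrix.reindexAlgEquiv ℂ ℂ (blockEquiv M n) X)ᴴ =
      Matrix.reindexAlgEquiv ℂ ℂ (blockEquiv M n) Xᴴ := rfl

/-- The square root of swap `(1 + i SWAP) / √2` on the first two of `m + 2` tensor factors `ℂ^ι`. -/
noncomputable def sqrtSwap (ι : Type) [DecidableEq ι] (m : ℕ) :
    Matrix (Fin (m + 2) → ι) (Fin (m + 2) → ι) ℂ :=
  ((√2 : ℝ) : ℂ)⁻¹ • (1 + Complex.I • tensorPerm ι (Equiv.swap 0 1))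

section sqrtSwap

variable (ι : Type) [DecidableEq ι] (m : ℕ)

theorem sqrtSwap_conjTranspose :
    (sqrtSwap ι m)ᴴ = ((√2 : ℝ) : ℂ)⁻¹ • (1 - Complex.I • tensorPerm ι (Equiv.swap 0 1)) := by
  rw [sqrtSwap, Matrix.conjTranspose_smul, Matrix.conjTranspose_add, Matrix.conjTranspose_smul,
    Matrix.conjTranspose_one, tensorPerm_conjTranspose, Equiv.symm_swap, star_inv₀,
    Complex.star_def, Complex.conj_ofReal, Complex.conj_I, neg_smul, sub_eq_add_neg]

variable [Fintype ι]

theorem sqrtSwap_conj (X : Matrix (Fin (m + 2) → ι) (Fin (m + 2) → ι) ℂ) :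
    sqrtSwap ι m * X * (sqrtSwap ι m)ᴴ = (2⁻¹ : ℂ) • (X +
      tensorPerm ι (Equiv.swap 0 1) * X * tensorPerm ι (Equiv.swap 0 1) +
      Complex.I • (tensorPerm ι (Equiv.swap 0 1) * X - X * tensorPerm ι (Equiv.swap 0 1))) := by
  rw [sqrtSwap_conjTranspose, sqrtSwap, Matrix.smul_mul, Matrix.smul_mul, Matrix.mul_smul,
    smul_smul, inv_sqrt_two_mul_self]
  congr 1
  simp only [add_mul, mul_sub, one_mul, mul_one, Matrix.smul_mul, Matrix.mul_smul, smul_sub,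
    smul_smul, Complex.I_mul_I, neg_smul, one_smul]
  abel

theorem sqrtSwap_mul_conjTranspose : sqrtSwap ι m * (sqrtSwap ι m)ᴴ = 1 := by
  have h := sqrtSwap_conj ι m 1
  rw [mul_one, mul_one, one_mul, sub_self, smul_zero, add_zero, tensorPerm_swap_mul_self,
    ← two_smul ℂ, smul_smul] at h
  simpa using h

theorem sqrtSwap_mul_tensorMat (A : Matrix ι ι ℂ) :
    sqrtSwap ι m * tensorMat (fun _ => A) = tensorMat (fun _ => A) * sqrtSwap ι m := by
  have h := tensorPerm_mul_tensorMat (Equiv.swap (0 : Fin (m + 2)) 1) fun _ => A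
  rw [sqrtSwap, Matrix.smul_mul, Matrix.mul_smul, add_mul, mul_add, Matrix.smul_mul,
    Matrix.mul_smul, h, one_mul, mul_one]
  rfl

end sqrtSwap

/-- The square root of swap on the first two of `m + 2` blocks of `n` qubits. -/
noncomputable def blockSqrtSwap (m n : ℕ) : QubitUnitary ((m + 2) * n) :=
  ⟨Matrix.reindexAlgEquiv ℂ ℂ (blockEquiv (m + 2) n) (sqrtSwap (QubitIdx n) m), by
    rw [Matrix.mem_unitaryGroup_iff, Matrix.star_eq_conjTranspose, reindexAlgEquiv_conjTranspose,
      ← map_mul, sqrtSwap_mul_conjTranspose, map_one]⟩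

theorem blockSqrtSwap_mem (m : ℕ) {n : ℕ} (𝓕 : Subgroup (QubitUnitary n)) :
    blockSqrtSwap m n ∈ symUnitaryGroup (collectiveGroup (m + 2) 𝓕) := by
  refine Subgroup.mem_centralizer_iff.mpr ?_
  rintro _ ⟨F, -, rfl⟩
  refine Subtype.ext ?_
  simp only [Submonoid.coe_mul, collective, blockSqrtSwap, MonoidHom.coe_mk, OneHom.coe_mk,
    ← map_mul, tensorPow, sqrtSwap_mul_tensorMat]

/-- If `Q` anticommutes with `P`, then the square root of swap rotates `P ⊗ 1` to an operator that
overlaps with `QP ⊗ Q`. -/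
theorem trace_sqrtSwap_conj_ne_zero {n : ℕ} (m : ℕ) {p q r : Fin n → Fin 4} {z : ℂ} (hq : q ≠ 0)
    (hr : r ≠ 0) (hpq : pauliString p * pauliString q = -(pauliString q * pauliString p))
    (hqp : pauliString q * pauliString p = z • pauliString r)
    {a b : Fin (m + 2) → Fin n → Fin 4} (ha : a = Fin.cons p 0)
    (hb : b = Fin.cons r (Fin.cons q 0)) :
    (tensorMat (fun k => pauliString (b k)) * (sqrtSwap (QubitIdx n) m *
      tensorMat (fun k => pauliString (a k)) * (sqrtSwap (QubitIdx n) m)ᴴ)).trace ≠ 0 := by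
  have ha0 : a 0 = p := by rw [ha, Fin.cons_zero]
  have ha1 : a 1 = 0 := by rw [ha, ← Fin.succ_zero_eq_one, Fin.cons_succ]; rfl
  have ha2 : ∀ k : Fin m, a k.succ.succ = 0 := fun k => by rw [ha, Fin.cons_succ]; rfl
  have hb0 : b 0 = r := by rw [hb, Fin.cons_zero]
  have hb1 : b 1 = q := by rw [hb, ← Fin.succ_zero_eq_one, Fin.cons_succ, Fin.cons_zero]
  have hb2 : ∀ k : Fin m, b k.succ.succ = 0 := fun k => by
    rw [hb, Fin.cons_succ, Fin.cons_succ]; rfl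
  set W := tensorPerm (QubitIdx n) (Equiv.swap (0 : Fin (m + 2)) 1) with hW
  -- In the expansion of the conjugation only the commutator of swap with `P ⊗ 1` contributes.
  have h1 : (tensorMat (fun k => pauliString (b k)) * tensorMat fun k => pauliString (a k)).trace
      = 0 := by
    rw [tensorMat_mul, trace_tensorMat]
    refine Finset.prod_eq_zero (Finset.mem_univ 1) ?_
    rw [ha1, hb1, trace_pauliString_mul, if_neg hq]
  have h2 : (tensorMat (fun k => pauliString (b k)) *
      (W * (tensorMat fun k => pauliString (a k)) * W)).trace = 0 := by
    rw [hW, tensorPerm_mul_tensorMat, mul_assoc (tensorMat _), tensorPerm_swap_mul_self, mul_one,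
      tensorMat_mul, trace_tensorMat]
    refine Finset.prod_eq_zero (Finset.mem_univ 0) ?_
    rw [Function.comp_apply, Equiv.symm_swap, Equiv.swap_apply_left, ha1, hb0,
      trace_pauliString_mul, if_neg hr]
  have h3 : (tensorMat (fun k => pauliString (b k)) *
      (W * (tensorMat fun k => pauliString (a k)))).trace =
      (pauliString p * pauliString r * pauliString q).trace * (2 ^ n) ^ m := by
    rw [Matrix.trace_mul_comm, mul_assoc, tensorMat_mul, trace_tensorPerm_swap_mul]
    simp [ha0, ha1, ha2, hb0, hb1, hb2, pauliString_zero]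
  have h4 : (tensorMat (fun k => pauliString (b k)) *
      ((tensorMat fun k => pauliString (a k)) * W)).trace =
      (pauliString r * pauliString p * pauliString q).trace * (2 ^ n) ^ m := by
    rw [← mul_assoc, Matrix.trace_mul_comm, tensorMat_mul, trace_tensorPerm_swap_mul]
    simp [ha0, ha1, ha2, hb0, hb1, hb2, pauliString_zero]
  have h5 : z * (pauliString p * pauliString r * pauliString q).trace = -2 ^ n := by
    rw [← smul_eq_mul, ← Matrix.trace_smul, ← Matrix.smul_mul, ← Matrix.mul_smul, ← hqp,
      ← mul_assoc, hpq, neg_mul, neg_mul, mul_assoc _ _ (pauliString p), pauliString_mul_self,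
      mul_one, pauliString_mul_self]
    simp
  have h6 : z * (pauliString r * pauliString p * pauliString q).trace = 2 ^ n := by
    rw [← smul_eq_mul, ← Matrix.trace_smul, ← Matrix.smul_mul, ← Matrix.smul_mul, ← hqp,
      mul_assoc _ _ (pauliString p), pauliString_mul_self, mul_one, pauliString_mul_self]
    simp
  rw [sqrtSwap_conj, ← hW, Matrix.mul_smul, Matrix.trace_smul, mul_add, mul_add, Matrix.mul_smul,
    mul_sub, Matrix.trace_add, Matrix.trace_add, Matrix.trace_smul, Matrix.trace_sub, h1, h2, h3,
    h4]
  intro h0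
  have hd : (2 : ℂ) ^ n ≠ 0 := pow_ne_zero _ two_ne_zero
  have hdm : ((2 : ℂ) ^ n) ^ m ≠ 0 := pow_ne_zero _ hd
  simp only [smul_eq_mul, mul_eq_zero, inv_eq_zero, OfNat.ofNat_ne_zero, false_or, zero_add,
    ← sub_mul, Complex.I_ne_zero, hdm, or_false] at h0
  have h7 : z * ((pauliString p * pauliString r * pauliString q).trace -
      (pauliString r * pauliString p * pauliString q).trace) = 0 := by rw [h0, mul_zero]
  rw [mul_sub, h5, h6] at h7
  refine hd ?_
  linear_combination (-1 / 2 : ℂ) * h7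

theorem trace_pauliString_mul_collective {M n : ℕ} (p : Fin M → Fin n → Fin 4)
    (F : QubitUnitary n) :
    (pauliString (fun j => p (finProdFinEquiv.symm j).1 (finProdFinEquiv.symm j).2) *
      (collective M n F).1).trace = ∏ k, (pauliString (p k) * F.1).trace := by
  rw [← reindex_tensorMat_pauliString]
  simp only [collective, MonoidHom.coe_mk, OneHom.coe_mk, ← map_mul, trace_reindexAlgEquiv,
    tensorPow, tensorMat_mul, trace_tensorMat]

/-- If the symmetric Clifford group is a symmetric 2-design, the Pauli coefficients of the elements
of `𝓕` satisfy a quadratic relation: with `Q` anticommuting with `P` and `R` proportional to `QP`,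
the operators `F^{⊗ M}` have coefficients of equal modulus at `P ⊗ 1 ⊗ ⋯` and `R ⊗ Q ⊗ 1 ⊗ ⋯`. -/
theorem exists_norm_trace_mul_eq {m n : ℕ} {𝓕 : Subgroup (QubitUnitary n)}
    (hd : IsSymmetricUnitaryDesign 2 (collectiveGroup (m + 2) 𝓕)
      (symCliffordGroup (collectiveGroup (m + 2) 𝓕))) {F : QubitUnitary n} (hF : F ∈ 𝓕)
    (hF0 : F.1.trace ≠ 0) {p : Fin n → Fin 4} (hp : p ≠ 0) :
    ∃ q r : Fin n → Fin 4, q ≠ 0 ∧ r ≠ 0 ∧ ‖(pauliString p * F.1).trace‖ * ‖F.1.trace‖ =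
      ‖(pauliString r * F.1).trace‖ * ‖(pauliString q * F.1).trace‖ := by
  obtain ⟨q, hpq⟩ := exists_pauliString_anticommute hp
  obtain ⟨z, r, hz, hqp⟩ := pauliString_mul q p
  have hq : q ≠ 0 := by
    rintro rfl
    refine pauliString_mul_ne_zero p 0 (Matrix.eq_zero_of_eq_neg ?_)
    simpa only [pauliString_zero, one_mul, mul_one] using hpq
  have hr : r ≠ 0 := by
    rintro rfl
    have h1 := congrArg Matrix.trace hpq
    rw [Matrix.trace_neg, Matrix.trace_mul_comm, self_eq_neg, trace_pauliString_mul] at h1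
    rw [pauliString_zero] at hqp
    have h2 := congrArg Matrix.trace hqp
    rw [trace_pauliString_mul, h1] at h2
    have hz0 : z ≠ 0 := by rintro rfl; norm_num at hz
    simp [hz0] at h2
  refine ⟨q, r, hq, hr, ?_⟩
  have hov := trace_sqrtSwap_conj_ne_zero m hq hr hpq hqp rfl rfl
  rw [← trace_reindexAlgEquiv, map_mul, map_mul, map_mul, ← reindexAlgEquiv_conjTranspose,
    reindex_tensorMat_pauliString, reindex_tensorMat_pauliString] at hov
  have h := norm_trace_pauliString_mul_eq_of_overlap hd (U := blockSqrtSwap m n)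
    (blockSqrtSwap_mem m 𝓕) hov (Subgroup.mem_map_of_mem _ hF)
  rw [trace_pauliString_mul_collective, trace_pauliString_mul_collective, Fin.prod_univ_succ,
    Fin.prod_univ_succ, Fin.prod_univ_succ, Fin.prod_univ_succ] at h
  simp only [Fin.cons_zero, Fin.cons_succ, Pi.zero_apply, pauliString_zero, one_mul, norm_mul,
    ← mul_assoc] at h
  refine mul_right_cancel₀ (norm_ne_zero_iff.mpr (Finset.prod_ne_zero_iff.mpr fun _ _ => hF0)) h

/-! ### Connected groups of collective symmetries -/

/-- If the trace of `F` dominates all its nontrivial Pauli coefficients, then these vanish: the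
quadratic relation fails for a largest coefficient that is nonzero. -/
theorem trace_pauliString_mul_eq_zero_of_dominant {m n : ℕ} {𝓕 : Subgroup (QubitUnitary n)}
    (hd : IsSymmetricUnitaryDesign 2 (collectiveGroup (m + 2) 𝓕)
      (symCliffordGroup (collectiveGroup (m + 2) 𝓕))) {F : QubitUnitary n} (hF : F ∈ 𝓕)
    (hdom : ∀ p : Fin n → Fin 4, p ≠ 0 → ‖(pauliString p * F.1).trace‖ < ‖F.1.trace‖)
    {p : Fin n → Fin 4} (hp : p ≠ 0) : (pauliString p * F.1).trace = 0 := by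
  obtain ⟨u, hu, hmax⟩ := (Finset.univ.filter fun p : Fin n → Fin 4 => p ≠ 0).exists_max_image
    (fun p => ‖(pauliString p * F.1).trace‖) ⟨p, by simpa using hp⟩
  simp only [Finset.mem_filter, Finset.mem_univ, true_and] at hu hmax
  have hF0 : 0 < ‖F.1.trace‖ := (norm_nonneg _).trans_lt (hdom u hu)
  obtain ⟨q, r, hq, hr, h⟩ := exists_norm_trace_mul_eq hd hF (norm_pos_iff.mp hF0) hu
  have hu0 : ‖(pauliString u * F.1).trace‖ ≤ 0 := by
    by_contra! hpos
    have h1 := mul_lt_mul_of_pos_left (hdom u hu) hpos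
    have h2 := mul_le_mul (hmax r hr) (hmax q hq) (norm_nonneg _) (norm_nonneg _)
    linarith
  exact norm_le_zero_iff.mp ((hmax p hp).trans hu0)

/-- The scalar elements of `𝓕` form an open and closed subset, hence are all of `𝓕`. -/
theorem exists_eq_smul_one_of_design {m n : ℕ} {𝓕 : Subgroup (QubitUnitary n)}
    (h𝓕 : IsConnectedLieSubgroup 𝓕)
    (hd : IsSymmetricUnitaryDesign 2 (collectiveGroup (m + 2) 𝓕)
      (symCliffordGroup (collectiveGroup (m + 2) 𝓕))) {F : QubitUnitary n} (hF : F ∈ 𝓕) :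
    ∃ c : ℂ, F.1 = c • 1 := by
  obtain ⟨d, L, _, _, _, _, _, φ, hrange, -, hsmooth, -⟩ := h𝓕
  have hφ : Continuous fun g : L => (φ g).1 := hsmooth.continuous
  have hf : ∀ p : Fin n → Fin 4, Continuous fun g : L => (pauliString p * (φ g).1).trace :=
    fun p => (continuous_const.mul hφ).matrix_trace
  have hmem : ∀ g, φ g ∈ 𝓕 := fun g => hrange ▸ ⟨g, rfl⟩
  -- By the dominance criterion the closed condition defining `S` is equivalent to an open one.
  set S : Set L := {g | ∀ p : Fin n → Fin 4, p ≠ 0 → (pauliString p * (φ g).1).trace = 0} with hS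
  have hS' : S = {g | ∀ p : Fin n → Fin 4, p ≠ 0 →
      ‖(pauliString p * (φ g).1).trace‖ < ‖(φ g).1.trace‖} := by
    ext g
    refine ⟨fun hg p hp => ?_, fun hg p hp =>
      trace_pauliString_mul_eq_zero_of_dominant hd (hmem g) hg hp⟩
    obtain ⟨c, hc⟩ := eq_smul_one_of_trace_pauliString hg
    have hc0 : c ≠ 0 := by
      rintro rfl
      have h1 : (φ g).1 * star (φ g).1 = 1 := Matrix.mem_unitaryGroup_iff.mp (φ g).2
      rw [hc, zero_smul, zero_mul] at h1
      exact zero_ne_one h1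
    rw [hg p hp, norm_zero, norm_pos_iff, hc, Matrix.trace_smul, Matrix.trace_one]
    simp [hc0]
  have hclosed : IsClosed S := by
    simp only [hS, Set.ofPred_forall]
    exact isClosed_iInter fun p => isClosed_iInter fun _ => isClosed_eq (hf p) continuous_const
  have hopen : IsOpen S := by
    simp only [hS', Set.ofPred_forall]
    exact isOpen_iInter_of_finite fun p => isOpen_iInter_of_finite fun _ =>
      isOpen_lt (hf p).norm hφ.matrix_trace.norm
  have hone : (1 : L) ∈ S := fun p hp => by
    rw [map_one, OneMemClass.coe_one, mul_one, trace_pauliString hp]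
  have huniv : S = Set.univ := IsClopen.eq_univ ⟨hclosed, hopen⟩ ⟨1, hone⟩
  obtain ⟨g, rfl⟩ : F ∈ φ.range := hrange ▸ hF
  have hg : g ∈ S := huniv ▸ Set.mem_univ g
  exact eq_smul_one_of_trace_pauliString hg

theorem symUnitaryGroup_eq_top_iff {N : ℕ} (𝒢 : Subgroup (QubitUnitary N)) :
    symUnitaryGroup 𝒢 = ⊤ ↔ ∀ G ∈ 𝒢, ∃ c : ℂ, G.1 = c • 1 := by
  rw [symUnitaryGroup, Subgroup.eq_top_iff']
  constructor
  · intro h G hG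
    refine eq_smul_one_of_trace_pauliString fun p hp => ?_
    obtain ⟨q, hq⟩ := exists_pauliString_anticommute hp
    exact trace_mul_eq_zero_of_anticommute (pauliString_mul_self q) hq
      (congrArg Subtype.val (Subgroup.mem_centralizer_iff.mp (h (pauliUnitary q)) G hG)).symm
  · intro h U
    refine Subgroup.mem_centralizer_iff.mpr fun G hG => Subtype.ext ?_
    obtain ⟨c, hc⟩ := h G hG
    rw [Submonoid.coe_mul, Submonoid.coe_mul, hc, Matrix.smul_mul, Matrix.mul_smul, one_mul,
      mul_one]

theorem exists_exp_smul_one_iff {ι : Type} [Fintype ι] [DecidableEq ι] [Nonempty ι]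
    (G : Matrix.unitaryGroup ι ℂ) :
    (∃ θ : ℝ, G.1 = Complex.exp (θ * Complex.I) • (1 : Matrix ι ι ℂ)) ↔ ∃ c : ℂ, G.1 = c • 1 := by
  refine ⟨fun ⟨θ, h⟩ => ⟨_, h⟩, fun ⟨c, hc⟩ => ?_⟩
  have h1 : G.1 * star G.1 = 1 := Matrix.mem_unitaryGroup_iff.mp G.2
  obtain ⟨i⟩ := ‹Nonempty ι›
  have h2 := congrFun (congrFun h1 i) i
  rw [hc, star_smul, star_one, Matrix.smul_mul, Matrix.mul_smul, one_mul, smul_smul,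
    Matrix.smul_apply, Matrix.one_apply_eq, smul_eq_mul, mul_one, Complex.star_def,
    Complex.mul_conj, Complex.normSq_eq_norm_sq] at h2
  have h3 : ‖c‖ = 1 := by
    have h4 : ‖c‖ ^ 2 = 1 := by exact_mod_cast h2
    exact (pow_eq_one_iff_of_nonneg (norm_nonneg c) two_ne_zero).mp h4
  obtain ⟨θ, hθ⟩ := (Complex.norm_eq_one_iff c).mp h3
  exact ⟨θ, by rw [hθ, hc]⟩

theorem collective_eq_smul_one {M n : ℕ} {F : QubitUnitary n} {c : ℂ} (hF : F.1 = c • 1) :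
    (collective M n F).1 = c ^ M • 1 := by
  have h : (tensorPow M F).1 = c ^ M • 1 := by
    simp only [tensorPow, MonoidHom.coe_mk, OneHom.coe_mk, hF, tensorMat_smul, tensorMat_one,
      Finset.prod_const, Finset.card_univ, Fintype.card_fin]
  simp only [collective, MonoidHom.coe_mk, OneHom.coe_mk, h, map_smul, map_one]

theorem theoremS5 (M n : ℕ) (hM : 2 ≤ M) (𝓕 : Subgroup (QubitUnitary n))
    (h𝓕 : IsConnectedLieSubgroup 𝓕) :
    (IsSymmetricUnitaryDesign 2 (collectiveGroup M 𝓕) (symCliffordGroup (collectiveGroup M 𝓕)) ↔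
      symUnitaryGroup (collectiveGroup M 𝓕) = ⊤) ∧
    (symUnitaryGroup (collectiveGroup M 𝓕) = ⊤ ↔
      ∀ G ∈ collectiveGroup M 𝓕, ∃ θ : ℝ,
        (G : Matrix (QubitIdx (M * n)) (QubitIdx (M * n)) ℂ) =
          Complex.exp (θ * Complex.I) • (1 : Matrix (QubitIdx (M * n)) (QubitIdx (M * n)) ℂ)) := by
  obtain ⟨m, rfl⟩ := Nat.exists_eq_add_of_le' hM
  refine ⟨⟨fun hd => ?_, fun htop => ?_⟩, ?_⟩
  · rw [symUnitaryGroup_eq_top_iff]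
    rintro _ ⟨F, hF, rfl⟩
    obtain ⟨c, hc⟩ := exists_eq_smul_one_of_design h𝓕 hd hF
    exact ⟨_, collective_eq_smul_one hc⟩
  · refine twirl_two_eq_of_clifford_le (le_inf le_rfl ?_) ?_ <;> rw [htop] <;> exact le_top
  · rw [symUnitaryGroup_eq_top_iff]
    exact forall₂_congr fun G _ => (exists_exp_smul_one_iff G).symm
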